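/- Let $\mathcal N$ be a finite nonempty set of $n\ge 1$ agents and $\mathcal M$ a finite set of items. Every agent $i\in\mathcal N$ has a non-negative additive valuation $v_i$, that is, $v_i(j)\ge 0$ for $j\in\mathcal M$ and $v_i(S)=\sum_{j\in S}v_i(j)$ for $S\subseteq\mathcal M$. An allocation $A$ is a collection of pairwise disjoint (possibly empty) bundles $A_i\subseteq\mathcal M$, $i\in\mathcal N$; it need not allocate all the items. It is Pareto optimal if there is no allocation $B$ with $v_i(B_i)\ge v_i(A_i)$ for all $i$ and $v_i(B_i)>v_i(A_i)$ for some $i$. A randomized allocation is a probability distribution over allocations. The truncated proportional share $TPS_i$ of agent $i$ is the largest $t\in\mathbb R$ such that $\frac1n\sum_{j\in\mathcal M}\min\{v_i(j),t\}=t$, and her maximin share $MMS_i$ is the maximum, over all partitions of $\mathcal M$ into $n$ (possibly empty) bundles, of the minimum value under $v_i$ of a bundle of the partition. Then there is a randomized allocation that - is supported on at most $n$ allocations; - is ex-ante proportional: the expected value of $v_i(A_i)$ is at least $\frac{v_i(\mathcal M)}{n}$ for every agent $i$; - has the following ex-post guarantees, for every allocation $A$ in its support: $v_i(A_i)\ge\frac12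 TPS_i$ and $v_i(A_i)\ge\frac12 MMS_i$ for every agent $i$, and $A$ is Pareto optimal. -/

import Mathlib

namespace FairDivision

/-- The value of a bundle `S` of items under the additive valuation with item values `w`. -/
def value {M : Type*} (w : M → ℝ) (S : Finset M) : ℝ := ∑ j ∈ S, w j

/-- A deterministic (integral) allocation: pairwise disjoint bundles, one for every agent. Some
bundles may be empty, and items may be left unallocated. -/
@[ext]
structure Allocation (N M : Type*) where
  bundle : N → Finset M
  disjoint : Pairwise fun i k => Disjoint (bundle i) (bundle k)

instance Allocation.instFinite {N M : Type*} [Finite N] [Finite M] : Finite (Allocation N M) :=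
  Finite.of_injective Allocation.bundle fun _ _ h => Allocation.ext h

noncomputable instance Allocation.instFintype {N M : Type*} [Finite N] [Finite M] :
    Fintype (Allocation N M) :=
  Fintype.ofFinite _

/-- The proportional share, in a setting with `n` agents, for the item values `w`. -/
noncomputable def proportionalShare {M : Type*} [Fintype M] (n : ℕ) (w : M → ℝ) : ℝ :=
  value w Finset.univ / n

/-- The truncated proportional share (TPS): the largest `t` with
`(1 / n) * ∑ j, min (w j) t = t`. The maximum is attained, see `isGreatest_truncatedShare`. -/
noncomputable def truncatedShare {M : Type*} [Fintype M] (n : ℕ) (w : M → ℝ) : ℝ :=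
  sSup {t : ℝ | (1 / (n : ℝ)) * ∑ j, min (w j) t = t}

theorem isGreatest_truncatedShare {M : Type*} [Fintype M] (n : ℕ) (w : M → ℝ)
    (hw : ∀ j, 0 ≤ w j) :
    IsGreatest {t : ℝ | (1 / (n : ℝ)) * ∑ j, min (w j) t = t} (truncatedShare n w) := by
  have hb : BddAbove {t : ℝ | (1 / (n : ℝ)) * ∑ j, min (w j) t = t} := by
    refine ⟨(1 / (n : ℝ)) * ∑ j, w j, fun t ht => ?_⟩
    rw [Set.mem_setOf_eq] at ht
    rw [← ht]
    gcongr
    exact min_le_left _ _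
  have hc : IsClosed {t : ℝ | (1 / (n : ℝ)) * ∑ j, min (w j) t = t} :=
    isClosed_eq (by fun_prop) continuous_id
  have h0 : (0 : ℝ) ∈ {t : ℝ | (1 / (n : ℝ)) * ∑ j, min (w j) t = t} := by
    simp [min_eq_right (hw _)]
  exact ⟨hc.csSup_mem ⟨0, h0⟩ hb, fun t ht => le_csSup hb ht⟩

/-- The maximin share (MMS): the maximum, over all partitions of the items into `n` (possibly
empty) bundles, of the lowest value of a bundle. A partition is given as the function that sends
every item to the index of its bundle. For `0 < n` there are finitely many and at least one
partition and bundle, so supremum and infimum are a maximum and a minimum. -/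
noncomputable def maximinShare {M : Type*} [Fintype M] (n : ℕ) (w : M → ℝ) : ℝ :=
  ⨆ P : M → Fin n, ⨅ k : Fin n, value w {j | P j = k}

/-- `B` Pareto dominates `A`: all agents weakly prefer `B`, at least one of them strictly. -/
def ParetoDominates {N M : Type*} (v : N → M → ℝ) (B A : Allocation N M) : Prop :=
  (∀ i, value (v i) (A.bundle i) ≤ value (v i) (B.bundle i)) ∧
    ∃ i, value (v i) (A.bundle i) < value (v i) (B.bundle i)

/-- An integral allocation is Pareto optimal if no integral allocation Pareto dominates it. -/
def IsParetoOptimal {N M : Type*} (v : N → M → ℝ) (A : Allocation N M) : Prop :=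
  ¬ ∃ B : Allocation N M, ParetoDominates v B A

/-- The ex-ante (expected) value of agent `i` under the randomized allocation `D`. -/
noncomputable def exAnteValue {N M : Type*} [Fintype N] [Fintype M] (v : N → M → ℝ)
    (D : PMF (Allocation N M)) (i : N) : ℝ :=
  ∑ A : Allocation N M, (D A).toReal * value (v i) (A.bundle i)

/-- A randomized allocation is ex-ante proportional if every agent gets at least her proportional
share in expectation. -/
def IsExAnteProportional {N M : Type*} [Fintype N] [Fintype M] (v : N → M → ℝ)
    (D : PMF (Allocation N M)) : Prop :=
  ∀ i, proportionalShare (Fintype.card N) (v i) ≤ exAnteValue v D i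

end FairDivision

namespace FairDivision

open Finset MeasureTheory

/-! Fix nonnegative weights `c` on the agents. It suffices to find one allocation that meets the
half-TPS bound and whose `c`-weighted welfare is at least that of the proportional shares. If no
mixture of admissible value vectors dominated the proportional shares, a separating hyperplane would
supply weights violating this (`exists_weights_of_forall_weighted`). Linear dependence then cuts the
support to n (`exists_weights_card_le`), Pareto improvements hurt nobody, and MMS is at most TPS.

For fixed `c`, picking by rank reduces to agents who rank the items identically. While some agent
values the top item at no less than her proportional share of what remains, it goes to the agent
with the largest weighted surplus (`exists_bundles_of_antitone`). Otherwise a moving knife gives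
everyone a head item and a fractional interval of the tail. Rounding all cuts by one uniform shift
preserves expected values and costs an agent at most the first tail item, which is worth no more
than her head item; so half survives. -/

/-! ### Reduction to a common ranking of the items. -/

/-- Item values can be listed in decreasing order, followed by zeros. -/
theorem exists_antitone_values {M : Type*} [Fintype M] (v : M → ℝ) (hv : ∀ j, 0 ≤ v j) :
    ∃ w : ℕ → ℝ, Antitone w ∧ (∀ k, 0 ≤ w k) ∧
      (∀ K, Fintype.card M ≤ K → ∀ f : ℝ → ℝ, f 0 = 0 → ∑ k ∈ range K, f (w k) = ∑ j, f (v j)) ∧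
      (∀ k (X : Finset M), #X ≤ k → 0 < w k → ∃ j ∉ X, w k ≤ v j) := by
  classical
  set m := Fintype.card M with hm
  set e : Fin m ≃ M := (Fintype.equivFin M).symm
  set σ := Tuple.sort fun a => -v (e a)
  have hσ : Antitone fun a => v (e (σ a)) := fun a b hab => by
    have := Tuple.monotone_sort (fun a => -v (e a)) hab
    simpa using this
  set w : ℕ → ℝ := fun k => if h : k < m then v (e (σ ⟨k, h⟩)) else 0 with hw
  have hwlt : ∀ k (h : k < m), w k = v (e (σ ⟨k, h⟩)) := fun k h => dif_pos h
  have hw0 : ∀ k, 0 ≤ w k := fun k => by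
    simp only [hw]
    split_ifs
    · exact hv _
    · exact le_rfl
  refine ⟨w, fun a b hab => ?_, hw0, fun K hK f hf => ?_, fun k X hX hk => ?_⟩
  · by_cases hb : b < m
    · rw [hwlt b hb, hwlt a (by omega)]
      exact hσ (by simpa using hab)
    · rw [show w b = 0 from dif_neg hb]
      exact hw0 a
  · rw [← sum_subset (range_subset_range.2 hK) (fun k _ hk => by
      rw [show w k = 0 from dif_neg (by simpa using hk), hf]), ← Fin.sum_univ_eq_sum_range,
      ← (σ.trans e).sum_comp]
    exact sum_congr rfl fun a _ => by rw [hwlt a a.2]; rfl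
  · have hkm : k < m := by
      by_contra h
      rw [show w k = 0 from dif_neg h] at hk
      exact hk.false
    -- The k + 1 items of rank at most k cannot all lie in `X`.
    obtain ⟨j, hj, hjX⟩ := exists_mem_notMem_of_card_lt_card
      (s := X) (t := (Iic (⟨k, hkm⟩ : Fin m)).image fun a => e (σ a)) (by
        rw [card_image_of_injective _ fun a b h => σ.injective (e.injective h), Fin.card_Iic]
        exact Nat.lt_succ_of_le hX)
    obtain ⟨a, ha, rfl⟩ := mem_image.1 hj
    exact ⟨_, hjX, by rw [hwlt k hkm]; exact hσ (mem_Iic.1 ha)⟩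

/-- Picking sequences: bundles of ranks can be turned into bundles of items that are at least as
valuable to the agents. -/
theorem exists_allocation_of_ranks {N M : Type*} (v : N → M → ℝ)
    (w : N → ℕ → ℝ)
    (hw : ∀ i k (X : Finset M), #X ≤ k → 0 < w i k → ∃ j ∉ X, w i k ≤ v i j)
    (B : N → Finset ℕ) (hB : Pairwise fun i j => Disjoint (B i) (B j)) (K : ℕ) :
    ∃ (A : Allocation N M) (X : Finset M), #X ≤ K ∧ (∀ i, A.bundle i ⊆ X) ∧
      ∀ i, ∑ k ∈ B i with k < K, w i k ≤ value (v i) (A.bundle i) := by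
  classical
  induction K with
  | zero => exact ⟨⟨fun _ => ∅, fun _ _ _ => disjoint_bot_left⟩, ∅, by simp, by simp,
      by simp [value]⟩
  | succ K ih =>
    obtain ⟨A, X, hX, hAX, hA⟩ := ih
    have hfilter : ∀ i, ∑ k ∈ B i with k < K + 1, w i k =
        ∑ k ∈ B i with k < K, w i k + if K ∈ B i then w i K else 0 := by
      intro i
      simp only [sum_filter]
      rw [← sum_ite_eq' (B i) K (w i), ← sum_add_distrib]
      refine sum_congr rfl fun k _ => ?_
      rcases lt_trichotomy k K with h | h | h
      · simp [h, h.ne, h.trans (Nat.lt_succ_self _)]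
      · simp [h]
      · simp [h.ne', h.not_gt, show ¬ k < K + 1 by omega]
    -- The owner of rank `K` picks next, when at most `K` items are gone. A rank of value zero needs
    -- no pick, and there may be no item left for it.
    by_cases hK : ∃ i, K ∈ B i ∧ 0 < w i K
    · obtain ⟨i, hiK, hpos⟩ := hK
      obtain ⟨j, hjX, hj⟩ := hw i K X hX hpos
      refine ⟨⟨Function.update A.bundle i (insert j (A.bundle i)), ?_⟩, insert j X,
        (card_insert_le _ _).trans (by omega), ?_, ?_⟩
      · intro a b hab
        have key : ∀ a, a ≠ i → Disjoint (insert j (A.bundle i)) (A.bundle a) := fun a ha =>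
          disjoint_insert_left.2 ⟨fun h => hjX (hAX a h), A.disjoint ha.symm⟩
        by_cases ha : a = i
        · subst ha
          simpa only [Function.update_self, Function.update_of_ne hab.symm] using key b hab.symm
        · by_cases hb : b = i
          · subst hb
            simpa only [Function.update_self, Function.update_of_ne ha] using (key a ha).symm
          · simpa only [Function.update_of_ne ha, Function.update_of_ne hb] using A.disjoint hab
      · intro a
        by_cases ha : a = i
        · subst ha
          simpa only [Function.update_self] using insert_subset_insert _ (hAX a)
        · simpa only [Function.update_of_ne ha] using (hAX a).trans (subset_insert _ _)
      · intro a
        rw [hfilter a]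
        by_cases ha : a = i
        · subst ha
          simp only [Function.update_self, value, if_pos hiK]
          rw [sum_insert fun h => hjX (hAX a h)]
          have := hA a
          rw [value] at this
          linarith
        · have haK : K ∉ B a := fun h => disjoint_left.1 (hB ha) h hiK
          simpa only [Function.update_of_ne ha, if_neg haK, add_zero] using hA a
    · push Not at hK
      refine ⟨A, X, hX.trans (Nat.le_succ _), hAX, fun i => ?_⟩
      rw [hfilter i]
      refine le_trans ?_ (hA i)
      rw [add_le_iff_nonpos_right]
      split_ifs with h
      · exact hK i h
      · exact le_rfl

/-! ### Pareto improvement and comparison of the shares. -/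

/-- Every allocation is weakly dominated by a Pareto optimal one. -/
theorem exists_isParetoOptimal_ge {N M : Type*} [Fintype N] [Fintype M] (v : N → M → ℝ)
    (A : Allocation N M) : ∃ B : Allocation N M,
      (∀ i, value (v i) (A.bundle i) ≤ value (v i) (B.bundle i)) ∧ IsParetoOptimal v B := by
  obtain ⟨B, hB, hmax⟩ := Set.exists_max_image
    {B : Allocation N M | ∀ i, value (v i) (A.bundle i) ≤ value (v i) (B.bundle i)}
    (fun B => ∑ i, value (v i) (B.bundle i)) (Set.toFinite _) ⟨A, fun _ => le_rfl⟩
  refine ⟨B, hB, ?_⟩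
  rintro ⟨C, hC, i, hi⟩
  exact (hmax C fun k => (hB k).trans (hC k)).not_gt
    (sum_lt_sum (fun k _ => hC k) ⟨i, mem_univ i, hi⟩)

/-- Truncating items at the maximin value `μ` leaves every bundle worth at least `μ`: either one
item alone reaches `μ`, or nothing is truncated. So the averaged truncated value is at least t at t
= `μ` and at most t for large t; a crossing in between is a solution above `μ`. -/
theorem maximinShare_le_truncatedShare {M : Type*} [Fintype M] {n : ℕ} (hn : 0 < n) (w : M → ℝ)
    (hw : ∀ j, 0 ≤ w j) : maximinShare n w ≤ truncatedShare n w := by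
  classical
  have : Nonempty (Fin n) := ⟨⟨0, hn⟩⟩
  have hn' : (0 : ℝ) < n := Nat.cast_pos.2 hn
  refine ciSup_le fun P => ?_
  set μ := ⨅ k : Fin n, value w {j | P j = k} with hμ
  have hμk : ∀ k, μ ≤ value w {j | P j = k} := fun k => ciInf_le (Set.finite_range _).bddBelow k
  have hμ0 : 0 ≤ μ := le_ciInf fun k => sum_nonneg fun j _ => hw j
  have hmin0 : ∀ j, 0 ≤ min (w j) μ := fun j => le_min (hw j) hμ0
  have hbundle : ∀ k, μ ≤ ∑ j with P j = k, min (w j) μ := fun k => by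
    by_cases h : ∃ j, P j = k ∧ μ ≤ w j
    · obtain ⟨j, hj, hle⟩ := h
      calc μ = min (w j) μ := (min_eq_right hle).symm
        _ ≤ _ := single_le_sum (f := fun j => min (w j) μ) (fun j _ => hmin0 j) (by simpa using hj)
    · push Not at h
      refine (hμk k).trans_eq (sum_congr rfl fun j hj => (min_eq_left ?_).symm)
      exact (h j (by simpa using hj)).le
  have hsum : n * μ ≤ ∑ j, min (w j) μ := by
    rw [← sum_fiberwise univ P]
    calc n * μ = ∑ _k : Fin n, μ := by simp
      _ ≤ _ := sum_le_sum fun k _ => hbundle k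
  set b := max μ ((1 / (n : ℝ)) * ∑ j, w j) with hb
  obtain ⟨t, ht, ht0⟩ := intermediate_value_Icc' (le_max_left μ _ : μ ≤ b)
    (f := fun t => (1 / (n : ℝ)) * ∑ j, min (w j) t - t)
    (by fun_prop) (show (0 : ℝ) ∈ _ from ⟨by
      rw [sub_nonpos]
      refine le_trans ?_ (le_max_right _ _)
      gcongr
      exact min_le_left _ _, by
      rw [sub_nonneg, one_div, le_inv_mul_iff₀ hn']
      exact hsum⟩)
  exact ht.1.trans ((isGreatest_truncatedShare n w hw).2 (sub_eq_zero.1 ht0))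

/-! ### Fractional intervals and their randomized rounding. -/

/-- The value of the initial segment `[0, x]` of a line on which item `k` occupies `[k, k + 1]`
and has value `z k` (negative positions belong to item `0`). -/
noncomputable def segmentValue (z : ℕ → ℝ) (x : ℝ) : ℝ := ∫ y in (0 : ℝ)..x, z ⌊y⌋₊

theorem intervalIntegrable_comp_floor {z : ℕ → ℝ} (hz : Antitone z) (a b : ℝ) :
    IntervalIntegrable (fun y : ℝ => z ⌊y⌋₊) volume a b :=
  (hz.comp_monotone Nat.floor_mono).intervalIntegrable

theorem segmentValue_sub {z : ℕ → ℝ} (hz : Antitone z) (x y : ℝ) :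
    segmentValue z y - segmentValue z x = ∫ t in x..y, z ⌊t⌋₊ :=
  intervalIntegral.integral_interval_sub_left (intervalIntegrable_comp_floor hz _ _)
    (intervalIntegrable_comp_floor hz _ _)

theorem continuous_segmentValue {z : ℕ → ℝ} (hz : Antitone z) : Continuous (segmentValue z) :=
  intervalIntegral.continuous_primitive (intervalIntegrable_comp_floor hz) 0

theorem monotone_segmentValue {z : ℕ → ℝ} (hz : Antitone z) (h0 : ∀ k, 0 ≤ z k) :
    Monotone (segmentValue z) := by
  intro x y hxy
  rw [← sub_nonneg, segmentValue_sub hz]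
  exact intervalIntegral.integral_nonneg hxy fun _ _ => h0 _

theorem segmentValue_natCast_add {z : ℕ → ℝ} (hz : Antitone z) (k : ℕ) {θ : ℝ} (h0 : 0 ≤ θ)
    (h1 : θ ≤ 1) : segmentValue z (k + θ) = segmentValue z k + θ * z k := by
  rw [← sub_eq_iff_eq_add', segmentValue_sub hz,
    intervalIntegral.integral_congr_Ioo_of_le (g := fun _ => z k) (by linarith)]
  · simp
  · intro x hx
    have : ⌊x⌋₊ = k := by
      rw [Nat.floor_eq_iff (by linarith [hx.1, Nat.cast_nonneg (α := ℝ) k])]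
      exact ⟨hx.1.le, by linarith [hx.2]⟩
    simp [this]

theorem segmentValue_natCast {z : ℕ → ℝ} (hz : Antitone z) (k : ℕ) :
    segmentValue z k = ∑ j ∈ range k, z j := by
  induction k with
  | zero => simp [segmentValue]
  | succ k ih =>
    rw [sum_range_succ, ← ih, Nat.cast_succ, segmentValue_natCast_add hz k zero_le_one le_rfl,
      one_mul]

theorem antitone_segmentValue_ceil {z : ℕ → ℝ} (hz : Antitone z) (h0 : ∀ k, 0 ≤ z k) (x : ℝ) :
    Antitone fun u : ℝ => segmentValue z ⌈x - u⌉₊ := fun _ _ h =>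
  monotone_segmentValue hz h0 (Nat.cast_le.2 (Nat.ceil_mono (by linarith)))

/-- Rounding a cut point `x` to `⌈x - u⌉₊` with `u` uniform in `[0, 1]` preserves values in
expectation. -/
theorem integral_segmentValue_ceil {z : ℕ → ℝ} (hz : Antitone z) (h0 : ∀ k, 0 ≤ z k) {x : ℝ}
    (hx : 0 ≤ x) : ∫ u in (0 : ℝ)..1, segmentValue z ⌈x - u⌉₊ = segmentValue z x := by
  obtain ⟨k, θ, hθ0, hθ1, rfl⟩ : ∃ (k : ℕ) (θ : ℝ), 0 ≤ θ ∧ θ < 1 ∧ x = k + θ :=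
    ⟨⌊x⌋₊, x - ⌊x⌋₊, by linarith [Nat.floor_le hx], by linarith [Nat.lt_floor_add_one x], by ring⟩
  have hi : ∀ a b : ℝ,
      IntervalIntegrable (fun u : ℝ => segmentValue z ⌈(k + θ : ℝ) - u⌉₊) volume a b :=
    fun a b => (antitone_segmentValue_ceil hz h0 _).intervalIntegrable
  -- Shifts below the fractional part `θ` round to k + 1, those above it to k; the average is the
  -- linear interpolation.
  rw [← intervalIntegral.integral_add_adjacent_intervals (hi 0 θ) (hi θ 1),
    intervalIntegral.integral_congr_Ioo_of_le (g := fun _ => segmentValue z (k + 1)) hθ0,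
    intervalIntegral.integral_congr_Ioo_of_le (g := fun _ => segmentValue z k) hθ1.le,
    segmentValue_natCast_add hz k zero_le_one le_rfl, segmentValue_natCast_add hz k hθ0 hθ1.le]
  · simp
    ring
  · intro u hu
    have : ⌈(k + θ : ℝ) - u⌉₊ = k := by
      apply le_antisymm
      · exact Nat.ceil_le.2 (by linarith [hu.1])
      · rcases k with _ | k
        · simp
        · refine Nat.succ_le_of_lt (Nat.lt_ceil.2 ?_)
          push_cast
          linarith [hu.2]
    simp [this]
  · intro u hu
    have : ⌈(k + θ : ℝ) - u⌉₊ = k + 1 := by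
      apply le_antisymm
      · refine Nat.ceil_le.2 ?_
        push_cast
        linarith [hu.1]
      · exact Nat.succ_le_of_lt (Nat.lt_ceil.2 (by linarith [hu.2]))
    simp [this]

/-- Rounding both ends of an interval with the same shift costs at most one item. -/
theorem segmentValue_ceil_sub_ge {z : ℕ → ℝ} (hz : Antitone z) (h0 : ∀ k, 0 ≤ z k)
    {a b u : ℝ} (hab : a ≤ b) (ha : 0 ≤ a) (hu0 : 0 ≤ u) (hu1 : u ≤ 1) :
    segmentValue z b - segmentValue z a - z 0 ≤
      segmentValue z ⌈b - u⌉₊ - segmentValue z ⌈a - u⌉₊ := by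
  have hm := monotone_segmentValue hz h0
  have h1 : segmentValue z (b - u) ≤ segmentValue z ⌈b - u⌉₊ := hm (Nat.le_ceil _)
  have h2 : segmentValue z ⌈a - u⌉₊ ≤ segmentValue z (a - u + 1) := by
    apply hm
    rcases le_or_gt 0 (a - u) with h | h
    · exact (Nat.ceil_lt_add_one h).le
    · rw [Nat.ceil_eq_zero.2 h.le]
      push_cast
      linarith
  -- Shifting left only moves onto denser value; giving negative positions the density `z 0` keeps
  -- this true across the origin.
  have h3 : segmentValue z b - segmentValue z a ≤
      segmentValue z (b - u) - segmentValue z (a - u) := by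
    rw [segmentValue_sub hz, segmentValue_sub hz,
      ← intervalIntegral.integral_comp_sub_right (fun y => z ⌊y⌋₊) u]
    refine intervalIntegral.integral_mono_on hab (intervalIntegrable_comp_floor hz _ _) ?_ ?_
    · exact Antitone.intervalIntegrable
        fun x y h => hz (Nat.floor_mono (by linarith))
    · exact fun x _ => hz (Nat.floor_mono (by linarith))
  have h4 : segmentValue z (a - u + 1) - segmentValue z (a - u) ≤ z 0 := by
    rw [segmentValue_sub hz]
    calc _ ≤ ∫ _ in (a - u)..(a - u + 1), z 0 :=
          intervalIntegral.integral_mono_on (by linarith) (intervalIntegrable_comp_floor hz _ _)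
            (by simp) fun x _ => hz (Nat.zero_le _)
      _ = z 0 := by simp
  linarith

/-! ### Bundles when all agents rank the items identically. -/

/-- A moving knife: every agent receives one of the head items `q, …, q + r - 1` and an interval
of a common tail, of total value at least `p i`. -/
theorem exists_headed_intervals {N : Type*} [DecidableEq N] (w : N → ℕ → ℝ) (V : N → ℝ → ℝ)
    (p : N → ℝ) (L : ℝ) (hVc : ∀ i, Continuous (V i)) (hVm : ∀ i, Monotone (V i)) (r : ℕ) :
    ∀ (R : Finset N) (q : ℕ) (a : ℝ), #R = r → a ≤ L →
      (∀ i ∈ R, ∀ k, q ≤ k → w i k ≤ p i) →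
      (∀ i ∈ R, r * p i ≤ ∑ k ∈ Ico q (q + r), w i k + (V i L - V i a)) →
      ∃ (h : N → ℕ) (lo hi : N → ℝ),
        (∀ i ∈ R, h i ∈ Ico q (q + r) ∧ a ≤ lo i ∧ lo i ≤ hi i ∧ hi i ≤ L ∧
          p i ≤ w i (h i) + (V i (hi i) - V i (lo i))) ∧
        ∀ i ∈ R, ∀ j ∈ R, i ≠ j → h i ≠ h j ∧ (hi i ≤ lo j ∨ hi j ≤ lo i) := by
  induction r with
  | zero =>
    intro R q a hR _ _ _
    rw [card_eq_zero] at hR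
    subst hR
    exact ⟨fun _ => 0, fun _ => 0, fun _ => 0, by simp, by simp⟩
  | succ r ih =>
    intro R q a hR haL hp hsum
    -- Item `q` alone is worth at most `p i`. With the whole tail it is worth at least `p i`, since
    -- the other r head items account for at most r shares.
    have hcut : ∀ i ∈ R, ∃ x ∈ Set.Icc a L, w i q + (V i x - V i a) = p i := by
      intro i hi
      have hc : ContinuousOn (fun x => w i q + (V i x - V i a)) (Set.Icc a L) :=
        (continuous_const.add ((hVc i).sub continuous_const)).continuousOn
      have h1 := hsum i hi
      have h2 : ∑ k ∈ Ico (q + 1) (q + (r + 1)), w i k ≤ r * p i := by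
        calc _ ≤ ∑ _k ∈ Ico (q + 1) (q + (r + 1)), p i :=
              sum_le_sum fun k hk => hp i hi k (by have := mem_Ico.1 hk; omega)
          _ = r * p i := by
              rw [sum_const, Nat.card_Ico, nsmul_eq_mul, show q + (r + 1) - (q + 1) = r by omega]
      rw [sum_eq_sum_Ico_succ_bot (by omega)] at h1
      push_cast at h1
      exact intermediate_value_Icc haL hc ⟨by simpa using hp i hi q le_rfl, by
        linarith⟩
    choose! x hx hxp using hcut
    -- The earliest cut wins: to the others, item `q` and the interval up to it are worth at most
    -- one share.
    obtain ⟨i, hi, hmin⟩ := exists_min_image R x (card_pos.1 (by omega))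
    obtain ⟨h, lo, hi', hH, hD⟩ := ih (R.erase i) (q + 1) (x i)
      (by rw [card_erase_of_mem hi]; omega) (hx i hi).2
      (fun j hj k hk => hp j (mem_of_mem_erase hj) k (by omega)) (by
        intro j hj
        have hj' := mem_of_mem_erase hj
        have h1 := hsum j hj'
        have h2 := hxp j hj'
        have h3 := hVm j (hmin j hj')
        rw [sum_eq_sum_Ico_succ_bot (by omega)] at h1
        rw [show q + 1 + r = q + (r + 1) by omega]
        push_cast at h1
        linarith)
    refine ⟨Function.update h i q, Function.update lo i a, Function.update hi' i (x i), ?_, ?_⟩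
    · intro j hj
      by_cases hji : j = i
      · subst hji
        simp only [Function.update_self]
        exact ⟨by simp, le_rfl, (hx j hj).1, (hx j hj).2, (hxp j hj).ge⟩
      · simp only [Function.update_of_ne hji]
        obtain ⟨h1, h2, h3⟩ := hH j (mem_erase.2 ⟨hji, hj⟩)
        rw [mem_Ico] at h1 ⊢
        exact ⟨by omega, (hx i hi).1.trans h2, h3⟩
    · have key : ∀ j ∈ R, j ≠ i → q ≠ h j ∧ x i ≤ lo j := fun j hj hji => by
        obtain ⟨h1, h2, h3⟩ := hH j (mem_erase.2 ⟨hji, hj⟩)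
        rw [mem_Ico] at h1
        exact ⟨by omega, h2⟩
      intro j hj k hk hjk
      by_cases hji : j = i
      · subst hji
        simp only [Function.update_self, Function.update_of_ne hjk.symm]
        exact ⟨(key k hk hjk.symm).1, Or.inl (key k hk hjk.symm).2⟩
      · by_cases hki : k = i
        · subst hki
          simp only [Function.update_self, Function.update_of_ne hji]
          exact ⟨(key j hj hji).1.symm, Or.inr (key j hj hji).2⟩
        · simp only [Function.update_of_ne hji, Function.update_of_ne hki]
          exact hD j (mem_erase.2 ⟨hji, hj⟩) k (mem_erase.2 ⟨hki, hk⟩) hjk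

/-- If every item is worth less than the proportional share to every agent, there are bundles of
high weighted welfare that give all agents half of their proportional shares. -/
theorem exists_bundles_of_small_items {N : Type*} [DecidableEq N] (w : N → ℕ → ℝ)
    (hw : ∀ i, Antitone (w i)) (h0 : ∀ i k, 0 ≤ w i k) (c : N → ℝ) (hc : ∀ i, 0 ≤ c i)
    (p : N → ℝ) (K s : ℕ) (R : Finset N) (hK : s + #R ≤ K)
    (hsmall : ∀ i ∈ R, w i s ≤ p i)
    (hsum : ∀ i ∈ R, #R * p i ≤ ∑ k ∈ Ico s K, w i k) :
    ∃ B : N → Finset ℕ, (∀ i ∈ R, B i ⊆ Ico s K ∧ p i / 2 ≤ ∑ k ∈ B i, w i k) ∧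
      (∀ i ∈ R, ∀ j ∈ R, i ≠ j → Disjoint (B i) (B j)) ∧
      ∑ i ∈ R, c i * p i ≤ ∑ i ∈ R, c i * ∑ k ∈ B i, w i k := by
  set q := s + #R with hq
  obtain ⟨L, rfl⟩ := Nat.exists_eq_add_of_le hK
  set z : N → ℕ → ℝ := fun i k => w i (q + k) with hz
  have hza : ∀ i, Antitone (z i) := fun i a b h => hw i (by omega)
  have hz0 : ∀ i k, 0 ≤ z i k := fun i k => h0 _ _
  have hVm := fun i => monotone_segmentValue (hza i) (hz0 i)
  have hIco : ∀ i (a b : ℕ), a ≤ b →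
      ∑ k ∈ Ico (q + a) (q + b), w i k = segmentValue (z i) b - segmentValue (z i) a := by
    intro i a b hab
    rw [segmentValue_natCast (hza i), segmentValue_natCast (hza i), ← sum_Ico_eq_sub _ hab, hz,
      sum_Ico_add (w i), add_comm a, add_comm b]
  obtain ⟨h, lo, hi, hH, hD⟩ := exists_headed_intervals w (fun i => segmentValue (z i)) p L
    (fun i => continuous_segmentValue (hza i)) hVm #R R s 0 rfl (Nat.cast_nonneg _)
    (fun i hi k hk => (hw i hk).trans (hsmall i hi)) (by
      intro i hi
      have h1 := hsum i hi
      have h2 := hIco i 0 L (Nat.zero_le _)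
      rw [← sum_Ico_consecutive _ (show s ≤ q by omega) (show q ≤ q + L by omega)] at h1
      simp only [add_zero, Nat.cast_zero] at h2
      linarith)
  set T : N → ℝ → ℝ := fun i u =>
    segmentValue (z i) ⌈hi i - u⌉₊ - segmentValue (z i) ⌈lo i - u⌉₊ with hT
  have hint : ∀ i (x : ℝ), IntervalIntegrable
      (fun u : ℝ => segmentValue (z i) ⌈x - u⌉₊) volume 0 1 :=
    fun i x => (antitone_segmentValue_ceil (hza i) (hz0 i) x).intervalIntegrable
  have hTint : ∀ i, IntervalIntegrable (fun u => c i * (w i (h i) + T i u)) volume 0 1 :=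
    fun i => ((intervalIntegrable_const).add ((hint i _).sub (hint i _))).const_mul _
  -- Some shift does at least as well as the mean. Sharing it among all agents keeps the rounded
  -- intervals disjoint.
  obtain ⟨u, hu, hub⟩ : ∃ u ∈ Set.Ioc (0 : ℝ) 1,
      ∑ i ∈ R, c i * p i ≤ ∑ i ∈ R, c i * (w i (h i) + T i u) := by
    obtain ⟨u, hu, hle⟩ := exists_setAverage_le (μ := volume) (s := Set.Ioc (0 : ℝ) 1)
      (f := fun u => ∑ i ∈ R, c i * (w i (h i) + T i u)) (by simp) (by simp)
      ((intervalIntegrable_iff_integrableOn_Ioc_of_le zero_le_one).1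
        (by simpa only [sum_fn] using IntervalIntegrable.sum R fun i _ => hTint i))
    refine ⟨u, hu, le_trans ?_ hle⟩
    rw [setAverage_eq, ← intervalIntegral.integral_of_le zero_le_one,
      intervalIntegral.integral_finsetSum fun i _ => hTint i]
    simp only [Real.volume_real_Ioc_of_le zero_le_one, sub_zero, inv_one, one_smul]
    refine sum_le_sum fun i hiR => ?_
    obtain ⟨-, h2, h3, h4, h5⟩ := hH i hiR
    rw [intervalIntegral.integral_const_mul, intervalIntegral.integral_add
      intervalIntegrable_const ((hint i _).sub (hint i _)), intervalIntegral.integral_sub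
      (hint i _) (hint i _), integral_segmentValue_ceil (hza i) (hz0 i) h2,
      integral_segmentValue_ceil (hza i) (hz0 i) (h2.trans h3)]
    simpa using mul_le_mul_of_nonneg_left h5 (hc i)
  set B : N → Finset ℕ := fun i =>
    insert (h i) (Ico (q + ⌈lo i - u⌉₊) (q + ⌈hi i - u⌉₊)) with hB
  have hval : ∀ i ∈ R, ∑ k ∈ B i, w i k = w i (h i) + T i u := by
    intro i hiR
    obtain ⟨h1, h2, h3, h4, h5⟩ := hH i hiR
    rw [mem_Ico] at h1
    rw [hB, sum_insert (by rw [mem_Ico]; omega), hIco _ _ _ (Nat.ceil_mono (by linarith))]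
  refine ⟨B, fun i hiR => ?_, fun i hiR j hjR hij => ?_, ?_⟩
  · obtain ⟨h1, h2, h3, h4, h5⟩ := hH i hiR
    rw [mem_Ico] at h1
    have hceil : ⌈hi i - u⌉₊ ≤ L := Nat.ceil_le.2 (by linarith [hu.1])
    refine ⟨?_, ?_⟩
    · intro k hk
      rw [hB, mem_insert, mem_Ico] at hk
      rw [mem_Ico]
      omega
    · rw [hval i hiR]
      -- The bundle is worth at least `p i - z i 0` and at least `w i (h i)`, which is at least `z i
      -- 0`; the two bounds add up to `p i`.
      have h6 := segmentValue_ceil_sub_ge (hza i) (hz0 i) h3 h2 hu.1.le hu.2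
      have h7 : 0 ≤ T i u :=
        sub_nonneg.2 (hVm i (Nat.cast_le.2 (Nat.ceil_mono (by linarith))))
      have h8 : z i 0 ≤ w i (h i) := hw i (by omega)
      have h9 : T i u = segmentValue (z i) ⌈hi i - u⌉₊ - segmentValue (z i) ⌈lo i - u⌉₊ := rfl
      linarith
  · obtain ⟨h1, h2, h3, h4, h5⟩ := hH i hiR
    obtain ⟨g1, g2, g3, g4, g5⟩ := hH j hjR
    obtain ⟨e1, e2⟩ := hD i hiR j hjR hij
    rw [mem_Ico] at h1 g1
    have e3 : ⌈hi i - u⌉₊ ≤ ⌈lo j - u⌉₊ ∨ ⌈hi j - u⌉₊ ≤ ⌈lo i - u⌉₊ :=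
      e2.imp (fun e => Nat.ceil_mono (by linarith)) fun e => Nat.ceil_mono (by linarith)
    rw [disjoint_left]
    intro k hk hk'
    simp only [hB, mem_insert, mem_Ico] at hk hk'
    omega
  · exact hub.trans_eq (sum_congr rfl fun i hiR => by rw [hval i hiR])

/-- In an instance in which all agents rank the items identically there are bundles of high
weighted welfare that give all agents half of their truncated proportional shares. -/
theorem exists_bundles_of_antitone {N : Type*} [DecidableEq N] (w : N → ℕ → ℝ)
    (hw : ∀ i, Antitone (w i)) (h0 : ∀ i k, 0 ≤ w i k) (c : N → ℝ) (hc : ∀ i, 0 ≤ c i)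
    (τ : N → ℝ) (K : ℕ) (r : ℕ) : ∀ (R : Finset N) (s : ℕ), #R = r → s + r ≤ K →
      (∀ i ∈ R, r * τ i ≤ ∑ k ∈ Ico s K, min (w i k) (τ i)) →
      ∃ B : N → Finset ℕ, (∀ i ∈ R, B i ⊆ Ico s K ∧ τ i / 2 ≤ ∑ k ∈ B i, w i k) ∧
        (∀ i ∈ R, ∀ j ∈ R, i ≠ j → Disjoint (B i) (B j)) ∧
        ∑ i ∈ R, c i * ∑ k ∈ Ico s K, w i k ≤ r * ∑ i ∈ R, c i * ∑ k ∈ B i, w i k := by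
  induction r with
  | zero =>
    intro R s hR _ _
    rw [card_eq_zero] at hR
    subst hR
    exact ⟨fun _ => ∅, by simp, by simp, by simp⟩
  | succ r ih =>
    intro R s hR hK hτ
    set W : N → ℝ := fun i => ∑ k ∈ Ico s K, w i k with hW
    have hτW : ∀ i ∈ R, ((r + 1 : ℕ) : ℝ) * τ i ≤ W i := fun i hi =>
      (hτ i hi).trans (sum_le_sum fun k _ => min_le_left _ _)
    have hr : (0 : ℝ) < (r + 1 : ℕ) := by positivity
    have hWs : ∀ i, W i = w i s + ∑ k ∈ Ico (s + 1) K, w i k := fun i =>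
      sum_eq_sum_Ico_succ_bot (by omega) _
    by_cases hbig : ∃ i ∈ R, W i ≤ (r + 1 : ℕ) * w i s
    · obtain ⟨i, hi, hmax⟩ := exists_max_image (R.filter fun i => W i ≤ (r + 1 : ℕ) * w i s)
        (fun i => c i * ((r + 1 : ℕ) * w i s - W i)) (by
          obtain ⟨i, hi, h⟩ := hbig
          exact ⟨i, mem_filter.2 ⟨hi, h⟩⟩)
      obtain ⟨hiR, hiW⟩ := mem_filter.1 hi
      -- Agents outside the filter have nonpositive surplus, so the maximum extends to all of `R`.
      have hmax' : ∀ j ∈ R, c j * ((r + 1 : ℕ) * w j s - W j) ≤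
          c i * ((r + 1 : ℕ) * w i s - W i) := by
        intro j hj
        by_cases hjW : W j ≤ (r + 1 : ℕ) * w j s
        · exact hmax j (mem_filter.2 ⟨hj, hjW⟩)
        · exact (mul_nonpos_of_nonneg_of_nonpos (hc j) (by linarith)).trans
            (mul_nonneg (hc i) (by linarith))
      obtain ⟨B, hB, hBd, hBw⟩ := ih (R.erase i) (s + 1) (by rw [card_erase_of_mem hiR]; omega)
        (by omega) (by
          -- Losing one item lowers the truncated sum by at most `τ j`, matching the loss of one
          -- agent.
          intro j hj
          have h1 := hτ j (mem_of_mem_erase hj)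
          rw [sum_eq_sum_Ico_succ_bot (by omega)] at h1
          have h2 := min_le_right (w j s) (τ j)
          push_cast at h1
          linarith)
      have hne : ∀ j ∈ R.erase i, Function.update B i {s} j = B j := fun j hj =>
        Function.update_of_ne (ne_of_mem_erase hj) _ _
      have hdisj : ∀ j ∈ R.erase i, Disjoint {s} (B j) := by
        intro j hj
        rw [disjoint_singleton_left]
        intro hs
        have := mem_Ico.1 ((hB j hj).1 hs)
        omega
      refine ⟨Function.update B i {s}, ?_, ?_, ?_⟩
      · intro j hj
        by_cases hji : j = i
        · subst hji
          rw [Function.update_self, sum_singleton]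
          refine ⟨by rw [singleton_subset_iff, mem_Ico]; omega, ?_⟩
          have : τ j ≤ w j s := le_of_mul_le_mul_left ((hτW j hj).trans hiW) hr
          linarith [h0 j s]
        · have hj' := mem_erase.2 ⟨hji, hj⟩
          rw [hne j hj']
          exact ⟨(hB j hj').1.trans (Ico_subset_Ico (by omega) le_rfl), (hB j hj').2⟩
      · intro j hj k hk hjk
        by_cases hji : j = i
        · subst hji
          have hk' := mem_erase.2 ⟨hjk.symm, hk⟩
          rw [Function.update_self, hne k hk']
          exact hdisj k hk'
        · have hj' := mem_erase.2 ⟨hji, hj⟩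
          by_cases hki : k = i
          · subst hki
            rw [Function.update_self, hne j hj']
            exact (hdisj j hj').symm
          · have hk' := mem_erase.2 ⟨hki, hk⟩
            rw [hne j hj', hne k hk']
            exact hBd j hj' k hk' hjk
      · have hupd : ∑ j ∈ R.erase i, c j * ∑ k ∈ Function.update B i {s} j, w j k =
            ∑ j ∈ R.erase i, c j * ∑ k ∈ B j, w j k := sum_congr rfl fun j hj => by rw [hne j hj]
        change ∑ j ∈ R, c j * W j ≤ _
        rw [← add_sum_erase _ _ hiR, ← add_sum_erase _ _ hiR, Function.update_self, sum_singleton,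
          hupd]
        set G := ∑ j ∈ R.erase i, c j * ∑ k ∈ B j, w j k with hG
        -- The main case cancels a factor `r`: the r remaining surpluses sum to at most r times that
        -- of `i`, which pays for the others' loss of item `s`.
        rcases Nat.eq_zero_or_pos r with rfl | hrpos
        · have hem : R.erase i = ∅ := card_eq_zero.1 (by rw [card_erase_of_mem hiR]; omega)
          rw [hG, hem, sum_empty, sum_empty]
          have := mul_le_mul_of_nonneg_left hiW (hc i)
          push_cast at this ⊢
          linarith
        · have hsumc : ∑ j ∈ R.erase i, c j * ((r + 1 : ℕ) * w j s - W j) ≤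
              r * (c i * ((r + 1 : ℕ) * w i s - W i)) := by
            refine (sum_le_card_nsmul _ _ _ fun j hj => hmax' j (mem_of_mem_erase hj)).trans ?_
            rw [card_erase_of_mem hiR, hR, nsmul_eq_mul, Nat.add_sub_cancel]
          have e1 : ∑ j ∈ R.erase i, c j * ((r + 1 : ℕ) * w j s - W j) =
              (r + 1 : ℕ) * ∑ j ∈ R.erase i, c j * w j s - ∑ j ∈ R.erase i, c j * W j := by
            rw [mul_sum, ← sum_sub_distrib]
            exact sum_congr rfl fun j _ => by ring
          have e2 : ∑ j ∈ R.erase i, c j * ∑ k ∈ Ico (s + 1) K, w j k =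
              ∑ j ∈ R.erase i, c j * W j - ∑ j ∈ R.erase i, c j * w j s := by
            rw [← sum_sub_distrib]
            exact sum_congr rfl fun j _ => by rw [hWs j]; ring
          rw [e1] at hsumc
          rw [e2] at hBw
          have hr' : (0 : ℝ) < r := by exact_mod_cast hrpos
          refine le_of_mul_le_mul_left ?_ hr'
          push_cast at hsumc ⊢
          have := mul_le_mul_of_nonneg_left hBw (show (0 : ℝ) ≤ r + 1 by positivity)
          linarith
    · push Not at hbig
      obtain ⟨B, hB, hBd, hBw⟩ := exists_bundles_of_small_items w hw h0 c hc
        (fun i => W i / (r + 1 : ℕ)) K s R (by omega)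
        (fun i hi => by rw [le_div_iff₀ hr]; linarith [hbig i hi])
        (fun i hi => by rw [hR, mul_div_cancel₀ _ hr.ne'])
      refine ⟨B, fun i hi => ⟨(hB i hi).1, le_trans ?_ (hB i hi).2⟩, hBd, ?_⟩
      · have : τ i ≤ W i / (r + 1 : ℕ) := by
          rw [le_div_iff₀ hr]
          linarith [hτW i hi]
        linarith
      · calc ∑ i ∈ R, c i * W i = (r + 1 : ℕ) * ∑ i ∈ R, c i * (W i / (r + 1 : ℕ)) := by
              rw [mul_sum]
              exact sum_congr rfl fun i _ => by field_simp
          _ ≤ _ := mul_le_mul_of_nonneg_left hBw hr.le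

/-! ### From weighted welfare to a distribution with small support. -/

/-- A distribution whose mean dominates `b` can be chosen with support of size at most the
dimension, provided that all values are nonnegative. -/
theorem exists_weights_card_le {α N : Type*} [Fintype α] [Fintype N] [Nonempty N]
    (g : α → N → ℝ) (hg : ∀ a i, 0 ≤ g a i) (b : N → ℝ)
    (h : ∃ p : α → ℝ, (∀ a, 0 ≤ p a) ∧ ∑ a, p a = 1 ∧ ∀ i, b i ≤ ∑ a, p a * g a i) :
    ∃ p : α → ℝ, (∀ a, 0 ≤ p a) ∧ ∑ a, p a = 1 ∧ (∀ i, b i ≤ ∑ a, p a * g a i) ∧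
      #{a | p a ≠ 0} ≤ Fintype.card N := by
  classical
  obtain ⟨p, ⟨hp0, hp1, hpb⟩, hmin⟩ := WellFounded.has_min
    (measure fun p : α → ℝ => #{a | p a ≠ 0}).wf
    {p | (∀ a, 0 ≤ p a) ∧ ∑ a, p a = 1 ∧ ∀ i, b i ≤ ∑ a, p a * g a i} h
  refine ⟨p, hp0, hp1, hpb, ?_⟩
  by_contra! hcard
  set S : Finset α := {a | p a ≠ 0} with hS
  have hmin' : ∀ q : α → ℝ, (∀ a, 0 ≤ q a) → ∑ a, q a = 1 →
      (∀ i, b i ≤ ∑ a, q a * g a i) → #S ≤ #{a | q a ≠ 0} := fun q h1 h2 h3 =>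
    not_lt.1 (hmin q ⟨h1, h2, h3⟩)
  -- Dependence of the value vectors alone, without the constraint of total mass, gives n rather
  -- than n + 1. The sign of `d` is chosen so that mass never grows.
  obtain ⟨d, hdS, hdg, hd1, a₀, ha₀⟩ : ∃ d : α → ℝ, (∀ a, a ∉ S → d a = 0) ∧
      (∀ i, ∑ a, d a * g a i = 0) ∧ ∑ a, d a ≤ 0 ∧ ∃ a, d a < 0 := by
    have hdep : ¬ LinearIndependent ℝ fun a : S => g a := fun hli => by
      have := hli.fintype_card_le_finrank
      rw [Module.finrank_fintype_fun_eq_card, Fintype.card_coe] at this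
      omega
    obtain ⟨e, he, x, hx⟩ := Fintype.not_linearIndependent_iff.1 hdep
    set d : α → ℝ := fun a => if h : a ∈ S then e ⟨a, h⟩ else 0 with hd
    have hdS : ∀ a, a ∉ S → d a = 0 := fun a ha => by simp [hd, ha]
    have hdx : d x ≠ 0 := by simpa [hd] using hx
    have hdg : ∀ i, ∑ a, d a * g a i = 0 := fun i => by
      have h1 := congrFun he i
      simp only [Finset.sum_apply, Pi.smul_apply, smul_eq_mul, Pi.zero_apply] at h1
      rw [← h1, ← sum_subset (subset_univ S) fun a _ ha => by rw [hdS a ha, zero_mul],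
        ← sum_coe_sort S]
      exact sum_congr rfl fun a _ => by simp [hd]
    have hneg : ∀ f : α → ℝ, f x ≠ 0 → ∑ a, f a ≤ 0 → ∃ a, f a < 0 := fun f hfx hf => by
      by_contra! hpos
      exact hfx ((sum_eq_zero_iff_of_nonneg fun a _ => hpos a).1
        (le_antisymm hf (sum_nonneg fun a _ => hpos a)) x (mem_univ _))
    rcases le_total (∑ a, d a) 0 with hle | hle
    · exact ⟨d, hdS, hdg, hle, hneg d hdx hle⟩
    · have hle' : ∑ a, -d a ≤ 0 := by simpa using hle
      exact ⟨fun a => -d a, fun a ha => by simp [hdS a ha], fun i => by simp [hdg i], hle',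
        hneg _ (by simpa using hdx) hle'⟩
  obtain ⟨x, hx, hxmin⟩ := exists_min_image ({a | d a < 0} : Finset α) (fun a => p a / -d a)
    ⟨a₀, by simpa using ha₀⟩
  have hdx : d x < 0 := by simpa using hx
  have hxS : x ∈ S := by
    by_contra hxS
    exact hdx.ne (hdS x hxS)
  -- The largest step keeping all weights nonnegative; it kills the weight of `x`.
  set t := p x / -d x with ht
  have ht0 : 0 ≤ t := div_nonneg (hp0 x) (by linarith)
  set q : α → ℝ := fun a => p a + t * d a with hq
  have hq0 : ∀ a, 0 ≤ q a := fun a => by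
    rcases lt_or_ge (d a) 0 with ha | ha
    · have h1 := hxmin a (by simpa using ha)
      rw [le_div_iff₀ (by linarith)] at h1
      simp only [hq]
      linarith
    · exact add_nonneg (hp0 a) (mul_nonneg ht0 ha)
  have hqx : q x = 0 := by
    simp only [hq, ht]
    rw [div_neg, neg_mul, div_mul_cancel₀ _ hdx.ne, add_neg_cancel]
  have hqS : ∀ a, q a ≠ 0 → a ∈ S.erase x := fun a ha => by
    refine mem_erase.2 ⟨fun h => ha (h ▸ hqx), ?_⟩
    by_contra haS
    apply ha
    have : p a = 0 := by simpa [hS] using haS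
    simp [hq, this, hdS a haS]
  have hqg : ∀ i, ∑ a, q a * g a i = ∑ a, p a * g a i := fun i => by
    simp only [hq, add_mul, sum_add_distrib, mul_assoc, ← mul_sum, hdg i, mul_zero, add_zero]
  have hqsum : ∑ a, q a ≤ 1 := by
    have : ∑ a, q a = 1 + t * ∑ a, d a := by rw [mul_sum, ← hp1, ← sum_add_distrib]
    rw [this]
    linarith [mul_nonpos_of_nonneg_of_nonpos ht0 hd1]
  -- If no mass is left, `b` is nonpositive and any point mass works. Otherwise rescaling to mass
  -- one only raises the mean, as values are nonnegative.
  rcases (sum_nonneg fun a (_ : a ∈ univ) => hq0 a).eq_or_lt with hzero | hpos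
  · have hq' : ∀ a, q a = 0 := fun a =>
      (sum_eq_zero_iff_of_nonneg fun a _ => hq0 a).1 hzero.symm a (mem_univ _)
    have := hmin' (Pi.single x 1) (fun a => by
        by_cases h : a = x
        · subst h; simp
        · simp [h]) (by simp)
      (fun i => by
        have h1 := hpb i
        rw [← hqg i] at h1
        simp only [hq', zero_mul, sum_const_zero] at h1
        exact h1.trans (sum_nonneg fun a _ => mul_nonneg (by
          by_cases h : a = x
          · subst h; simp
          · simp [h]) (hg a i)))
    have h2 : #{a | (Pi.single x 1 : α → ℝ) a ≠ 0} ≤ #{x} := card_le_card fun a ha => by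
      by_contra h
      rw [mem_singleton] at h
      rw [mem_filter, Pi.single_eq_of_ne h] at ha
      exact ha.2 rfl
    rw [card_singleton] at h2
    have := Fintype.card_pos (α := N)
    omega
  · have := hmin' (fun a => q a / ∑ a, q a) (fun a => div_nonneg (hq0 a) hpos.le)
      (by rw [← sum_div, div_self hpos.ne']) (fun i => by
        have : ∑ a, q a / (∑ a, q a) * g a i = (∑ a, q a * g a i) / ∑ a, q a := by
          rw [sum_div]
          exact sum_congr rfl fun a _ => by ring
        rw [this, hqg i]
        refine (hpb i).trans (le_div_self (sum_nonneg fun a _ => mul_nonneg (hp0 a) (hg a i))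
          hpos hqsum))
    have h2 : #{a | q a / ∑ a, q a ≠ 0} ≤ #(S.erase x) := card_le_card fun a ha => hqS a fun h0 => by
      simp [h0] at ha
    rw [card_erase_of_mem hxS] at h2
    have := card_pos.2 ⟨x, hxS⟩
    omega

/-- If every nonnegative weighting of the coordinates admits a point of at least the weighted value
of `b`, then some distribution over the points has a mean that dominates `b`. -/
theorem exists_weights_of_forall_weighted {α N : Type*} [Fintype α] [Fintype N]
    (g : α → N → ℝ) (b : N → ℝ)
    (h : ∀ c : N → ℝ, (∀ i, 0 ≤ c i) → ∃ a, ∑ i, c i * b i ≤ ∑ i, c i * g a i) :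
    ∃ p : α → ℝ, (∀ a, 0 ≤ p a) ∧ ∑ a, p a = 1 ∧ ∀ i, b i ≤ ∑ a, p a * g a i := by
  classical
  by_cases hdisj : Disjoint (convexHull ℝ (Set.range g)) (Set.Ici b)
  · exfalso
    obtain ⟨f, u, v, hfu, huv, hfv⟩ := geometric_hahn_banach_compact_closed
      (convex_convexHull ℝ (Set.range g)) ((Set.finite_range g).isCompact_convexHull ℝ)
      (convex_Ici b) isClosed_Ici hdisj
    set c : N → ℝ := fun i => f (Pi.single i 1) with hc
    have hf : ∀ y : N → ℝ, f y = ∑ i, c i * y i := fun y => by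
      conv_lhs => rw [pi_eq_sum_univ' y]
      simp [hc, mul_comm]
    have hc0 : ∀ i, 0 ≤ c i := fun i => by
      by_contra! hneg
      -- A negative coefficient would make `f` unbounded below on the orthant.
      obtain ⟨n, hn⟩ := exists_nat_gt ((f b - v) / -c i)
      rw [div_lt_iff₀ (by linarith)] at hn
      have h1 := hfv (b + (n : ℝ) • Pi.single i 1) (by
        rw [Set.mem_Ici, le_add_iff_nonneg_right]
        exact smul_nonneg (Nat.cast_nonneg n) (Pi.single_nonneg.2 zero_le_one))
      rw [map_add, map_smul, smul_eq_mul] at h1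
      change v < f b + n * c i at h1
      linarith
    obtain ⟨a, ha⟩ := h c hc0
    rw [← hf, ← hf] at ha
    have h1 := hfu (g a) (subset_convexHull ℝ _ ⟨a, rfl⟩)
    have h2 := hfv b (Set.mem_Ici.2 le_rfl)
    linarith
  · obtain ⟨y, hy, hby⟩ := Set.not_disjoint_iff.1 hdisj
    rw [convexHull_range_eq_exists_affineCombination] at hy
    obtain ⟨s, p, hp0, hp1, rfl⟩ := hy
    rw [s.affineCombination_eq_linear_combination _ _ hp1] at hby
    refine ⟨fun a => if a ∈ s then p a else 0, fun a => ?_, by simpa using hp1, fun i => ?_⟩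
    · dsimp only
      split_ifs with ha
      · exact hp0 a ha
      · exact le_rfl
    · simpa using hby i

/-! ### Assembly. -/

/-- For every weighting of the agents there is an allocation that gives all agents half of their
truncated proportional shares, and whose weighted welfare is at least that of the proportional
shares. -/
theorem exists_allocation_half_truncatedShare {N M : Type*} [Fintype N] [Nonempty N] [Fintype M]
    (v : N → M → ℝ) (hv : ∀ i j, 0 ≤ v i j) (c : N → ℝ) (hc : ∀ i, 0 ≤ c i) :
    ∃ A : Allocation N M,
      (∀ i, (1 / 2 : ℝ) * truncatedShare (Fintype.card N) (v i) ≤ value (v i) (A.bundle i)) ∧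
      ∑ i, c i * proportionalShare (Fintype.card N) (v i) ≤
        ∑ i, c i * value (v i) (A.bundle i) := by
  classical
  set n := Fintype.card N with hn
  -- Below, `K` pads the ranking with n zero-valued ranks, so that there are at least as many ranks
  -- as agents.
  have hn0 : (0 : ℝ) < n := Nat.cast_pos.2 Fintype.card_pos
  choose w hwa hw0 hwsum hwpick using fun i => exists_antitone_values (v i) (hv i)
  set K := Fintype.card M + n with hK
  have hτ : ∀ i, n * truncatedShare n (v i) ≤
      ∑ k ∈ Ico 0 K, min (w i k) (truncatedShare n (v i)) := fun i => by
    obtain ⟨h1, h2⟩ := isGreatest_truncatedShare n (v i) (hv i)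
    have h3 : 0 ≤ truncatedShare n (v i) := h2 (by
      change (1 / (n : ℝ)) * ∑ j, min (v i j) 0 = 0
      simp [min_eq_right (hv i _)])
    rw [← range_eq_Ico, hwsum i K (by omega) (fun x => min x (truncatedShare n (v i)))
      (min_eq_left h3)]
    change (1 / (n : ℝ)) * ∑ j, min (v i j) (truncatedShare n (v i)) = _ at h1
    rw [one_div, inv_mul_eq_iff_eq_mul₀ hn0.ne'] at h1
    exact h1.ge
  obtain ⟨B, hB, hBd, hBw⟩ := exists_bundles_of_antitone w hwa hw0 c hc
    (fun i => truncatedShare n (v i)) K n univ 0 card_univ (by omega) fun i _ => hτ i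
  obtain ⟨A, -, -, -, hA⟩ := exists_allocation_of_ranks v w hwpick B
    (fun i j hij => hBd i (mem_univ i) j (mem_univ j) hij) K
  have hA' : ∀ i, ∑ k ∈ B i, w i k ≤ value (v i) (A.bundle i) := fun i => by
    have h1 := hA i
    rwa [filter_true_of_mem fun k hk => (mem_Ico.1 ((hB i (mem_univ i)).1 hk)).2] at h1
  refine ⟨A, fun i => ?_, ?_⟩
  · have := (hB i (mem_univ i)).2
    linarith [hA' i]
  · have h1 : ∑ i, c i * proportionalShare n (v i) =
        (∑ i, c i * ∑ k ∈ Ico 0 K, w i k) / n := by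
      rw [sum_div]
      refine sum_congr rfl fun i _ => ?_
      have h2 : ∑ k ∈ range K, w i k = ∑ j, v i j := hwsum i K (by omega) id rfl
      rw [← range_eq_Ico, h2, proportionalShare, value, mul_div_assoc]
    rw [h1, div_le_iff₀' hn0]
    exact hBw.trans (mul_le_mul_of_nonneg_left
      (sum_le_sum fun i _ => mul_le_mul_of_nonneg_left (hA' i) (hc i)) hn0.le)

end FairDivision

theorem corollary1p6 {N M : Type*} [Fintype N] [Nonempty N] [Fintype M]
    (v : N → M → ℝ) (hv : ∀ i j, 0 ≤ v i j) :
    ∃ D : PMF (FairDivision.Allocation N M),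
      D.support.encard ≤ (Fintype.card N : ℕ∞) ∧
      FairDivision.IsExAnteProportional v D ∧
      ∀ A ∈ D.support,
        (∀ i, (1 / 2 : ℝ) * FairDivision.truncatedShare (Fintype.card N) (v i) ≤
          FairDivision.value (v i) (A.bundle i)) ∧
        (∀ i, (1 / 2 : ℝ) * FairDivision.maximinShare (Fintype.card N) (v i) ≤
          FairDivision.value (v i) (A.bundle i)) ∧
        FairDivision.IsParetoOptimal v A := by
  classical
  -- Mixing only over admissible Pareto optimal allocations makes the ex-post guarantees hold on any
  -- support.
  set F : Set (FairDivision.Allocation N M) := {A |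
    (∀ i, (1 / 2 : ℝ) * FairDivision.truncatedShare (Fintype.card N) (v i) ≤
      FairDivision.value (v i) (A.bundle i)) ∧ FairDivision.IsParetoOptimal v A} with hF
  obtain ⟨p, hp0, hp1, hpv, hcard⟩ := FairDivision.exists_weights_card_le
    (fun (A : F) i => FairDivision.value (v i) (A.1.bundle i))
    (fun A i => Finset.sum_nonneg fun j _ => hv i j) _
    (FairDivision.exists_weights_of_forall_weighted _
      (fun i => FairDivision.proportionalShare (Fintype.card N) (v i)) fun c hc => by
        obtain ⟨A, hA, hAc⟩ := FairDivision.exists_allocation_half_truncatedShare v hv c hc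
        obtain ⟨B, hAB, hB⟩ := FairDivision.exists_isParetoOptimal_ge v A
        exact ⟨⟨B, fun i => (hA i).trans (hAB i), hB⟩, hAc.trans
          (Finset.sum_le_sum fun i _ => mul_le_mul_of_nonneg_left (hAB i) (hc i))⟩)
  set q : FairDivision.Allocation N M → ℝ := fun A => if h : A ∈ F then p ⟨A, h⟩ else 0 with hq
  have hqF : ∀ A : F, q A = p A := fun A => dif_pos A.2
  have hqnF : ∀ A, A ∉ F → q A = 0 := fun A hA => dif_neg hA
  have hq0 : ∀ A, 0 ≤ q A := fun A => by
    by_cases h : A ∈ F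
    · rw [hqF ⟨A, h⟩]
      exact hp0 _
    · rw [hqnF A h]
  have hqsum : ∀ f : FairDivision.Allocation N M → ℝ,
      ∑ A, q A * f A = ∑ A : F, p A * f A := fun f => by
    rw [← Finset.sum_subset (Finset.subset_univ F.toFinset) fun A _ hA => by
      rw [hqnF A (by simpa using hA), zero_mul],
      Finset.sum_subtype F.toFinset (p := (· ∈ F)) (by simp)]
    exact Finset.sum_congr rfl fun A _ => by rw [hqF A]
  have hq1 : ∑ A, q A = 1 := by simpa [hp1] using hqsum fun _ => 1
  have hD1 : ∑ A, ENNReal.ofReal (q A) = 1 := by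
    rw [← ENNReal.ofReal_sum_of_nonneg fun A _ => hq0 A, hq1, ENNReal.ofReal_one]
  have hsupp : ∀ A, A ∈ (PMF.ofFintype _ hD1).support → ∃ h : A ∈ F, p ⟨A, h⟩ ≠ 0 := by
    intro A hA
    have hqA : q A ≠ 0 := fun h0 => by simp [h0] at hA
    by_cases h : A ∈ F
    · exact ⟨h, by rwa [← hqF ⟨A, h⟩]⟩
    · exact absurd (hqnF A h) hqA
  refine ⟨PMF.ofFintype _ hD1, ?_, fun i => ?_, fun A hA => ?_⟩
  · have hsub : (PMF.ofFintype _ hD1).support ⊆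
        ((Finset.univ.filter fun A : F => p A ≠ 0).image Subtype.val :
          Set (FairDivision.Allocation N M)) := fun A hA => by
      obtain ⟨h, hp⟩ := hsupp A hA
      simpa using ⟨h, hp⟩
    refine (Set.encard_le_encard hsub).trans ?_
    rw [Set.encard_coe_eq_coe_finsetCard]
    exact_mod_cast Finset.card_image_le.trans hcard
  · rw [FairDivision.exAnteValue]
    simp only [PMF.ofFintype_apply, ENNReal.toReal_ofReal (hq0 _)]
    rw [hqsum]
    exact hpv i
  · obtain ⟨⟨hT, hP⟩, -⟩ := hsupp A hA
    refine ⟨hT, fun i => le_trans ?_ (hT i), hP⟩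
    gcongr
    exact FairDivision.maximinShare_le_truncatedShare Fintype.card_pos (v i) (hv i)
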